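/- Let $B>0$, let $D=(0,\infty)\times(0,B)$ with coordinates $(x,y)$, let $\|\cdot\|$ and $(\cdot,\cdot)$ denote the norm and the scalar product of the real space $L^2(D)$ (also the integral over $D$ of a product of functions), and let $\gamma\in(0,\tfrac18)$, $k\in(0,\tfrac14)$ and $a^2=\pi^2/B^2>1$. Consider the problem $$u_t+\Delta^2u+\gamma\Delta u+\Delta u_x+uu_x-\partial_x^5u=0\quad\text{in } D\times(0,T),$$ $$u|_{\partial D}=0,\qquad u_x(0,y,t)=0,\qquad u_{yy}(x,0,t)=u_{yy}(x,B,t)=0,\qquad u(x,y,0)=u_0(x,y).$$ A regular solution on $(0,T)$, $0<T<\infty$, is a function $u:[0,T]\to L^2(D)$ with $u(0)=u_0$ which is the primitive of an integrable function $u_t:(0,T)\to L^2(D)$, such that $$u\in L^\infty(0,T;H^2(D))\cap L^2(0,T;H^4(D)),\quad \partial_x^5u\in L^2(0,T;L^2(D)),\quad u_t\in L^\infty(0,T;L^2(D))\cap L^2(0,T;H^2(D)),$$ such that the equation holds almost everywhere in $D$ for almost every $t\in(0,T)$, and such that the boundary conditions hold in the sense of traces for almost every $t\in(0,T)$. Assume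 that $u_0\in H^4(D)$, $\partial_x^5u_0\in L^2(D)$, that $$u_0(0,y)=u_{0x}(0,y)=u_0(x,0)=u_0(x,B)=u_{0yy}(x,0)=u_{0yy}(x,B)=0$$ in the sense of traces, that $\lim_{x\to+\infty}\partial_x^iu_0(x,y)=0$ for $i=0,1,2,3$ and almost every $y\in(0,B)$ (as essential limits in $x$), that $$J_w=\int_De^{kx}\big[|\Delta^2u_0|^2+|\Delta u_0|^2+u_0^2u_{0x}^2+|\partial_x^5u_0|^2\big]\,dx\,dy<\infty,$$ and that $$(e^{kx},u_0^2)=\int_De^{kx}u_0^2\,dx\,dy<\frac{9}{8k}a^2.$$ Then for every $T\in(0,\infty)$ every regular solution $u$ on $(0,T)$ satisfies $$\|u(t)\|^2\le\|u_0\|^2e^{-\frac12a^2t}\qquad\text{for all } t\in[0,T].$$ In particular, if $u$ is a regular solution on $(0,T)$ for every $T>0$, the inequality holds for all $t\ge0$. -/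

import Mathlib

open MeasureTheory Filter Topology Set

noncomputable section

/-- The right half-strip `D = (0, ∞) × (0, B)`. -/
def halfStrip (B : ℝ) : Set (ℝ × ℝ) := Ioi 0 ×ˢ Ioo 0 B

/-- The side `x = 0` of the half-strip. -/
def leftSide (B : ℝ) : Set (ℝ × ℝ) := {0} ×ˢ Icc 0 B

/-- The two sides `y = 0` and `y = B` of the half-strip. -/
def horizontalSides (B : ℝ) : Set (ℝ × ℝ) := Ici 0 ×ˢ {0, B}

/-- The real Hilbert space `L²(D)`; its norm is the norm `‖·‖` of the statement. -/
abbrev L2 (B : ℝ) : Type := Lp ℝ 2 (volume.restrict (halfStrip B))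

/-- The classical partial derivative `∂φ/∂x`. -/
def partialX (φ : ℝ × ℝ → ℝ) : ℝ × ℝ → ℝ := fun p => fderiv ℝ φ p (1, 0)

/-- The classical partial derivative `∂φ/∂y`. -/
def partialY (φ : ℝ × ℝ → ℝ) : ℝ × ℝ → ℝ := fun p => fderiv ℝ φ p (0, 1)

/-- `φ ∈ C_c^∞(ℝ²)`. -/
def IsSmoothCompact (φ : ℝ × ℝ → ℝ) : Prop :=
  ContDiff ℝ (⊤ : ℕ∞) φ ∧ HasCompactSupport φ

/-- `g ∈ L²(D)` is the weak derivative `D_x^i D_y^j f` of `f ∈ L²(D)` in `D`. -/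
def HasWeakDeriv (B : ℝ) (i j : ℕ) (f g : L2 B) : Prop :=
  ∀ φ : ℝ × ℝ → ℝ, IsSmoothCompact φ → tsupport φ ⊆ halfStrip B →
    ∫ p in halfStrip B, f p * (partialX^[i] (partialY^[j] φ)) p
      = (-1) ^ (i + j) * ∫ p in halfStrip B, g p * φ p

open Classical in
/-- The weak derivative `D_x^i D_y^j f` as an element of `L²(D)`. It is unique when it exists;
the default value `0` is used when `f` has no such weak derivative in `L²(D)`. -/
def weakD (B : ℝ) (i j : ℕ) (f : L2 B) : L2 B :=
  if h : ∃ g : L2 B, HasWeakDeriv B i j f g then h.choose else 0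

/-- `f ∈ H^m(D)`. -/
def MemH (B : ℝ) (m : ℕ) (f : L2 B) : Prop :=
  ∀ i j : ℕ, i + j ≤ m → ∃ g : L2 B, HasWeakDeriv B i j f g

/-- The trace of `w ∈ H^1(D)` vanishes on `Γ ⊆ ∂D`: `w` is a limit in `H^1(D)` of functions in
`C_c^∞(ℝ²)` whose support does not meet `Γ`. For `Γ = ∂D` this says `w ∈ H^1_0(D)`. -/
def VanishesOn (B : ℝ) (Γ : Set (ℝ × ℝ)) (w : L2 B) : Prop :=
  MemH B 1 w ∧ ∀ ε : ENNReal, 0 < ε → ∃ φ : ℝ × ℝ → ℝ,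
    IsSmoothCompact φ ∧ Disjoint (tsupport φ) Γ ∧
    eLpNorm (fun p => φ p - w p) 2 (volume.restrict (halfStrip B)) < ε ∧
    eLpNorm (fun p => partialX φ p - weakD B 1 0 w p) 2 (volume.restrict (halfStrip B)) < ε ∧
    eLpNorm (fun p => partialY φ p - weakD B 0 1 w p) 2 (volume.restrict (halfStrip B)) < ε

/-- The boundary conditions
`f|_{∂D} = 0`, `f_x(0, y) = 0`, `f_yy(x, 0) = f_yy(x, B) = 0`, in the sense of traces. -/
structure BoundaryConditions (B : ℝ) (f : L2 B) : Prop where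
  zero : VanishesOn B (leftSide B ∪ horizontalSides B) f
  dx : VanishesOn B (leftSide B) (weakD B 1 0 f)
  dyy : VanishesOn B (horizontalSides B) (weakD B 0 2 f)

/-- The Laplacian `Δf = f_xx + f_yy`. -/
def laplacian (B : ℝ) (f : L2 B) : L2 B := weakD B 2 0 f + weakD B 0 2 f

/-- The bi-Laplacian `Δ²f = f_xxxx + 2 f_xxyy + f_yyyy`. -/
def bilaplacian (B : ℝ) (f : L2 B) : L2 B :=
  weakD B 4 0 f + (2 : ℝ) • weakD B 2 2 f + weakD B 0 4 f

/-- `Δf_x = f_xxx + f_xyy`. -/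
def laplacianDx (B : ℝ) (f : L2 B) : L2 B := weakD B 3 0 f + weakD B 1 2 f

/-- `D_x^i D_y^j u ∈ L^q(0, T; L²(D))`. -/
def DerivMemBochner (B T : ℝ) (q : ENNReal) (i j : ℕ) (u : ℝ → L2 B) : Prop :=
  (∀ᵐ t ∂volume.restrict (Ioo 0 T), ∃ g : L2 B, HasWeakDeriv B i j (u t) g) ∧
    MemLp (fun t => weakD B i j (u t)) q (volume.restrict (Ioo 0 T))

/-- `u ∈ L^q(0, T; H^m(D))`. -/
def MemBochner (B T : ℝ) (q : ENNReal) (m : ℕ) (u : ℝ → L2 B) : Prop :=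
  ∀ i j : ℕ, i + j ≤ m → DerivMemBochner B T q i j u

/-- `v = u_t` on `(0, T)`: `u : [0, T] → L²(D)` is the (absolutely continuous) Bochner
primitive of `v ∈ L¹(0, T; L²(D))`. -/
def HasTimeDeriv (B T : ℝ) (u v : ℝ → L2 B) : Prop :=
  IntegrableOn v (Ioo 0 T) volume ∧
    ∀ t ∈ Icc (0 : ℝ) T, u t = u 0 + ∫ s in Ioo 0 t, v s

/-- `u` is a regular solution on `(0, T)`, with time derivative `v = u_t`, of
`u_t + Δ²u + γ Δu + Δu_x + u u_x - D_x^5 u = 0` in `D × (0, T)`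
with the boundary conditions above and `u(0) = u₀`. -/
structure IsRegularSolutionWith (B γ T : ℝ) (u₀ : L2 B) (u v : ℝ → L2 B) : Prop where
  timeDeriv : HasTimeDeriv B T u v
  memLinfH2 : MemBochner B T ⊤ 2 u
  memL2H4 : MemBochner B T 2 4 u
  memL2Dx5 : DerivMemBochner B T 2 5 0 u
  timeDeriv_memLinfL2 : MemBochner B T ⊤ 0 v
  timeDeriv_memL2H2 : MemBochner B T 2 2 v
  equation : ∀ᵐ t ∂volume.restrict (Ioo 0 T), ∀ᵐ p ∂volume.restrict (halfStrip B),
    v t p + bilaplacian B (u t) p + γ * laplacian B (u t) p + laplacianDx B (u t) p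
      + u t p * weakD B 1 0 (u t) p - weakD B 5 0 (u t) p = 0
  boundary : ∀ᵐ t ∂volume.restrict (Ioo 0 T), BoundaryConditions B (u t)
  initial : u 0 = u₀

/-- `u` is a regular solution on `(0, T)`. -/
def IsRegularSolution (B γ T : ℝ) (u₀ : L2 B) (u : ℝ → L2 B) : Prop :=
  ∃ v : ℝ → L2 B, IsRegularSolutionWith B γ T u₀ u v

/-- The weighted quantity
`J_w = ∫_D e^{kx} (|Δ²u₀|² + |Δu₀|² + u₀² u₀ₓ² + |D_x^5 u₀|²) dx dy ∈ [0, ∞]`. -/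
def weightedJ (B k : ℝ) (u₀ : L2 B) : ENNReal :=
  ∫⁻ p in halfStrip B, ENNReal.ofReal (Real.exp (k * p.1) *
    ((bilaplacian B u₀ p) ^ 2 + (laplacian B u₀ p) ^ 2
      + (u₀ p) ^ 2 * (weakD B 1 0 u₀ p) ^ 2 + (weakD B 5 0 u₀ p) ^ 2))

/-- `(e^{kx}, f²) = ∫_D e^{kx} f² dx dy ∈ [0, ∞]`. -/
def weightedSq (B k : ℝ) (f : L2 B) : ENNReal :=
  ∫⁻ p in halfStrip B, ENNReal.ofReal (Real.exp (k * p.1) * (f p) ^ 2)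

/-- The conditions on the initial datum, except for the smallness condition. The limits
`D_x^i u₀ → 0` as `x → ∞`, `i ≤ 3`, are essential limits in `x` for almost every `y`, hence
do not depend on the representatives. -/
structure AdmissibleDatum (B k : ℝ) (u₀ : L2 B) : Prop where
  memH4 : MemH B 4 u₀
  dx5 : ∃ g : L2 B, HasWeakDeriv B 5 0 u₀ g
  boundary : BoundaryConditions B u₀
  weightedJ_lt_top : weightedJ B k u₀ < ⊤
  limits : ∀ i ≤ 3, ∀ᵐ y ∂volume.restrict (Ioo 0 B),
    Tendsto (fun x : ℝ => weakD B i 0 u₀ (x, y)) (atTop ⊓ ae volume) (𝓝 0)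

end

/-! The proof is the unweighted energy estimate: pair the equation with `u` in `L²(D)` for almost
every fixed time. The bi-Laplacian gives `‖Δu‖²` (`inner_bilaplacian_self`) and `γΔu` gives
`-γ‖∇u‖²` (`inner_laplacian_self`). After integrations by parts, the odd-order terms become `-(u_xx,
u_x) - (u_xy, u_y)` and `-(u_xxx, u_xx)`. These are nonnegative because `(w_x, w) ≤ 0` on the
half-strip for every `w` with `w_x ∈ L²(D)` (`HasWeakDeriv.inner_nonpos`): formally, `(w_x, w)` is
minus half the integral of `w²` over the side `x = 0`. The nonlinear term integrates to zero
(`VanishesOn.inner_eq_zero_of_eq_mul`).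

The coercivity comes from the sharp Poincaré inequality in `y` (`VanishesOn.norm_sq_le`): `a²‖u‖² ≤
‖∇u‖² = -(Δu, u) ≤ ‖Δu‖ ‖u‖`. Hence `a²‖u‖ ≤ ‖Δu‖`, and, since `a² > 1`, also `‖∇u‖ ≤ ‖Δu‖`. Thus
`‖Δu‖²` absorbs both `γ‖∇u‖²` and `(a²/4)‖u‖²`, which yields `(u_t, u) ≤ -(a²/4)‖u‖²`. A Gronwall
argument for Lipschitz curves in a Hilbert space (`norm_sq_le_of_inner_le`) turns this into the
decay rate `a²/2`.

All integrations by parts are done against test functions approximating the factor with vanishing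
trace, so no trace operator or boundary integral occurs. -/

/-! ### Test functions -/

theorem isOpen_halfStrip (B : ℝ) : IsOpen (halfStrip B) := isOpen_Ioi.prod isOpen_Ioo

theorem measurableSet_halfStrip (B : ℝ) : MeasurableSet (halfStrip B) :=
  (isOpen_halfStrip B).measurableSet

namespace IsSmoothCompact

variable {φ ψ : ℝ × ℝ → ℝ}

theorem differentiable (hφ : IsSmoothCompact φ) : Differentiable ℝ φ :=
  hφ.1.differentiable (by simp)

theorem continuous (hφ : IsSmoothCompact φ) : Continuous φ := hφ.1.continuous

theorem fderiv_apply (hφ : IsSmoothCompact φ) (e : ℝ × ℝ) :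
    IsSmoothCompact (fun p => fderiv ℝ φ p e) :=
  ⟨(hφ.1.fderiv_right (m := (⊤ : ℕ∞)) (by simp)).clm_apply contDiff_const,
    hφ.2.fderiv_apply ℝ e⟩

theorem partialX (hφ : IsSmoothCompact φ) : IsSmoothCompact (partialX φ) :=
  hφ.fderiv_apply (1, 0)

theorem partialY (hφ : IsSmoothCompact φ) : IsSmoothCompact (partialY φ) :=
  hφ.fderiv_apply (0, 1)

theorem mul_left (hφ : IsSmoothCompact φ) {c : ℝ × ℝ → ℝ} (hc : ContDiff ℝ (⊤ : ℕ∞) c) :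
    IsSmoothCompact (fun p => c p * φ p) :=
  ⟨hc.mul hφ.1, hφ.2.mul_left⟩

theorem add (hφ : IsSmoothCompact φ) (hψ : IsSmoothCompact ψ) : IsSmoothCompact (φ + ψ) :=
  ⟨hφ.1.add hψ.1, hφ.2.add hψ.2⟩

theorem sub (hφ : IsSmoothCompact φ) (hψ : IsSmoothCompact ψ) : IsSmoothCompact (φ - ψ) :=
  ⟨hφ.1.sub hψ.1, hφ.2.sub hψ.2⟩

theorem const_smul (hφ : IsSmoothCompact φ) (c : ℝ) : IsSmoothCompact (c • φ) :=
  ⟨contDiff_const.smul hφ.1, hφ.2.smul_left (f := fun _ => c)⟩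

theorem memLp (hφ : IsSmoothCompact φ) (μ : Measure (ℝ × ℝ)) [IsFiniteMeasureOnCompacts μ] :
    MemLp φ 2 μ :=
  hφ.continuous.memLp_of_hasCompactSupport hφ.2

/-- The restriction of a test function to the half-strip. -/
noncomputable def toL2 (hφ : IsSmoothCompact φ) (B : ℝ) : L2 B :=
  (hφ.memLp (volume.restrict (halfStrip B))).toLp φ

theorem coeFn_toL2 (hφ : IsSmoothCompact φ) (B : ℝ) :
    hφ.toL2 B =ᵐ[volume.restrict (halfStrip B)] φ := MemLp.coeFn_toLp _

theorem toL2_sub (hφ : IsSmoothCompact φ) (hψ : IsSmoothCompact ψ) (B : ℝ) :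
    (hφ.sub hψ).toL2 B = hφ.toL2 B - hψ.toL2 B := rfl

end IsSmoothCompact

theorem tsupport_partialX_subset (φ : ℝ × ℝ → ℝ) : tsupport (partialX φ) ⊆ tsupport φ :=
  tsupport_fderiv_apply_subset ℝ _

theorem tsupport_partialY_subset (φ : ℝ × ℝ → ℝ) : tsupport (partialY φ) ⊆ tsupport φ :=
  tsupport_fderiv_apply_subset ℝ _

theorem IsSmoothCompact.partialY_partialX_comm {φ : ℝ × ℝ → ℝ} (hφ : IsSmoothCompact φ) :
    _root_.partialY (_root_.partialX φ) = _root_.partialX (_root_.partialY φ) := by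
  funext p
  have hd : Differentiable ℝ (fderiv ℝ φ) :=
    (hφ.1.fderiv_right (m := (⊤ : ℕ∞)) (by simp)).differentiable (by simp)
  have hsymm : IsSymmSndFDerivAt ℝ φ p :=
    (hφ.1.contDiffAt).isSymmSndFDerivAt 
      (by rw [minSmoothness_of_isRCLikeNormedField]; exact WithTop.coe_le_coe.2 (le_top (a := (2 : ℕ∞))))
  have key : ∀ e d : ℝ × ℝ, fderiv ℝ (fun q => fderiv ℝ φ q e) p d
      = fderiv ℝ (fderiv ℝ φ) p d e := by
    intro e d
    rw [fderiv_clm_apply (hd p) (differentiableAt_const e)]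
    simp
  change fderiv ℝ (fun q => fderiv ℝ φ q (1, 0)) p (0, 1)
    = fderiv ℝ (fun q => fderiv ℝ φ q (0, 1)) p (1, 0)
  rw [key, key]
  exact hsymm.eq _ _

theorem IsSmoothCompact.iterate_partialY_partialX {φ : ℝ × ℝ → ℝ} (hφ : IsSmoothCompact φ)
    (j : ℕ) : _root_.partialY^[j] (_root_.partialX φ) = _root_.partialX (_root_.partialY^[j] φ) := by
  induction j generalizing φ with
  | zero => rfl
  | succ j ih =>
    rw [Function.iterate_succ_apply, hφ.partialY_partialX_comm, ih hφ.partialY,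
      Function.iterate_succ_apply]

theorem IsSmoothCompact.hasDerivAt_x {φ : ℝ × ℝ → ℝ} (hφ : IsSmoothCompact φ) (x y : ℝ) :
    HasDerivAt (fun s => φ (s, y)) (_root_.partialX φ (x, y)) x := by
  have h := (hφ.differentiable (x, y)).hasFDerivAt.comp_hasDerivAt x
    ((hasDerivAt_id x).prodMk (hasDerivAt_const x y))
  exact h

theorem IsSmoothCompact.hasDerivAt_y {φ : ℝ × ℝ → ℝ} (hφ : IsSmoothCompact φ) (x y : ℝ) :
    HasDerivAt (fun s => φ (x, s)) (_root_.partialY φ (x, y)) y := by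
  have h := (hφ.differentiable (x, y)).hasFDerivAt.comp_hasDerivAt y
    ((hasDerivAt_const y x).prodMk (hasDerivAt_id y))
  exact h

/-! ### Weak derivatives -/

theorem inner_eq_integral {B : ℝ} (f g : L2 B) :
    inner ℝ f g = ∫ p in halfStrip B, f p * g p := by
  rw [L2.inner_def]
  congr 1
  funext p
  simp [mul_comm]

theorem inner_toL2 {B : ℝ} (f : L2 B) {φ : ℝ × ℝ → ℝ} (hφ : IsSmoothCompact φ) :
    inner ℝ f (hφ.toL2 B) = ∫ p in halfStrip B, f p * φ p := by
  rw [inner_eq_integral]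
  refine integral_congr_ae ?_
  filter_upwards [hφ.coeFn_toL2 B] with p hp
  rw [hp]

theorem eq_zero_of_forall_integral_eq_zero {B : ℝ} {f : L2 B}
    (h : ∀ φ : ℝ × ℝ → ℝ, IsSmoothCompact φ → tsupport φ ⊆ halfStrip B →
      ∫ p in halfStrip B, f p * φ p = 0) : f = 0 := by
  have hloc : LocallyIntegrableOn f (halfStrip B) (volume.restrict (halfStrip B)) :=
    (MemLp.locallyIntegrable (Lp.memLp f) (by norm_num)).locallyIntegrableOn _
  have := (isOpen_halfStrip B).ae_eq_zero_of_integral_contDiff_smul_eq_zero hloc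
    (fun g hg hc hs => by simpa [mul_comm] using h g ⟨hg, hc⟩ hs)
  rw [Lp.eq_zero_iff_ae_eq_zero]
  filter_upwards [this, ae_restrict_mem (measurableSet_halfStrip B)] with p hp hpD
  exact hp hpD

namespace HasWeakDeriv

variable {B : ℝ} {i j : ℕ} {f g h : L2 B}

theorem unique (hg : HasWeakDeriv B i j f g) (hh : HasWeakDeriv B i j f h) : g = h := by
  rw [← sub_eq_zero]
  refine eq_zero_of_forall_integral_eq_zero fun φ hφ hs => ?_
  have h1 := (hg φ hφ hs).symm.trans (hh φ hφ hs)
  have h2 := mul_left_cancel₀ (pow_ne_zero _ (by norm_num : (-1 : ℝ) ≠ 0)) h1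
  rw [← inner_toL2 _ hφ, inner_sub_left, inner_toL2, inner_toL2, h2, sub_self]

theorem weakD_eq (hg : HasWeakDeriv B i j f g) : weakD B i j f = g := by
  have hex : ∃ g : L2 B, HasWeakDeriv B i j f g := ⟨g, hg⟩
  rw [weakD, dif_pos hex]
  exact hex.choose_spec.unique hg

/-- Test the derivative of order `(i, j)` with `∂ₓφ`. Since `HasWeakDeriv` applies the
`y`-derivatives first, `∂ₓ` must be commuted past them; `succ_y` needs no such step. -/
theorem succ_x (hg : HasWeakDeriv B i j f g) (hh : HasWeakDeriv B (i + 1) j f h) :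
    HasWeakDeriv B 1 0 g h := by
  intro φ hφ hs
  have h1 := hh φ hφ hs
  have h2 := hg (partialX φ) hφ.partialX ((tsupport_partialX_subset φ).trans hs)
  rw [hφ.iterate_partialY_partialX, ← Function.iterate_succ_apply, h1] at h2
  have h3 : ((-1 : ℝ) ^ (i + j)) ≠ 0 := pow_ne_zero _ (by norm_num)
  apply mul_left_cancel₀ h3
  change _ * ∫ p in halfStrip B, g p * partialX φ p = _
  rw [← h2]
  ring

theorem succ_y (hg : HasWeakDeriv B i j f g) (hh : HasWeakDeriv B i (j + 1) f h) :
    HasWeakDeriv B 0 1 g h := by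
  intro φ hφ hs
  have h1 := hh φ hφ hs
  have h2 := hg (partialY φ) hφ.partialY ((tsupport_partialY_subset φ).trans hs)
  rw [← Function.iterate_succ_apply, h1] at h2
  have h3 : ((-1 : ℝ) ^ (i + j)) ≠ 0 := pow_ne_zero _ (by norm_num)
  apply mul_left_cancel₀ h3
  change _ * ∫ p in halfStrip B, g p * partialY φ p = _
  rw [← h2]
  ring

end HasWeakDeriv

theorem hasWeakDeriv_zero_zero {B : ℝ} (f : L2 B) : HasWeakDeriv B 0 0 f f := by
  intro φ _ _
  simp

theorem hasWeakDeriv_weakD {B : ℝ} {i j : ℕ} {f : L2 B}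
    (h : ∃ g : L2 B, HasWeakDeriv B i j f g) : HasWeakDeriv B i j f (weakD B i j f) := by
  obtain ⟨g, hg⟩ := h
  rwa [hg.weakD_eq]

/-- The test functions supported in the half-strip, as a subspace of `L²`. -/
def testSubspace (B : ℝ) : Submodule ℝ (L2 B) where
  carrier := {f | ∃ (φ : ℝ × ℝ → ℝ) (hφ : IsSmoothCompact φ), tsupport φ ⊆ halfStrip B ∧
    hφ.toL2 B = f}
  add_mem' := by
    rintro _ _ ⟨φ, hφ, hs, rfl⟩ ⟨ψ, hψ, hs', rfl⟩
    exact ⟨φ + ψ, hφ.add hψ, (tsupport_add φ ψ).trans (union_subset hs hs'), rfl⟩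
  zero_mem' := ⟨0, ⟨contDiff_const, HasCompactSupport.zero⟩, by simp [tsupport], rfl⟩
  smul_mem' := by
    rintro c _ ⟨φ, hφ, hs, rfl⟩
    exact ⟨c • φ, hφ.const_smul c, (tsupport_smul_subset_right (fun _ => c) φ).trans hs, rfl⟩

/-- Density by duality: an element orthogonal to all test functions is zero by the fundamental lemma
of the calculus of variations. -/
theorem testSubspace_topologicalClosure (B : ℝ) : (testSubspace B).topologicalClosure = ⊤ := by
  rw [Submodule.topologicalClosure_eq_top_iff, Submodule.eq_bot_iff]
  intro f hf
  refine eq_zero_of_forall_integral_eq_zero fun φ hφ hs => ?_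
  rw [← inner_toL2 f hφ, real_inner_comm]
  exact hf _ ⟨φ, hφ, hs, rfl⟩

theorem exists_test_seq {B : ℝ} (w : L2 B) :
    ∃ (φ : ℕ → ℝ × ℝ → ℝ) (hφ : ∀ n, IsSmoothCompact (φ n)),
      (∀ n, tsupport (φ n) ⊆ halfStrip B) ∧
      Tendsto (fun n => (hφ n).toL2 B) atTop (𝓝 w) := by
  have hw : w ∈ closure (testSubspace B : Set (L2 B)) := by
    rw [← Submodule.topologicalClosure_coe, testSubspace_topologicalClosure]
    trivial
  obtain ⟨s, hs, hlim⟩ := mem_closure_iff_seq_limit.1 hw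
  choose φ hφ hsub heq using hs
  exact ⟨φ, hφ, hsub, by simpa only [heq] using hlim⟩

/-- Approximation of a function with vanishing trace, in terms of sequences. -/
theorem VanishesOn.exists_seq {B : ℝ} {Γ : Set (ℝ × ℝ)} {w : L2 B} (h : VanishesOn B Γ w) :
    ∃ (φ : ℕ → ℝ × ℝ → ℝ) (hφ : ∀ n, IsSmoothCompact (φ n)),
      (∀ n, Disjoint (tsupport (φ n)) Γ) ∧
      Tendsto (fun n => (hφ n).toL2 B) atTop (𝓝 w) ∧
      Tendsto (fun n => (hφ n).partialX.toL2 B) atTop (𝓝 (weakD B 1 0 w)) ∧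
      Tendsto (fun n => (hφ n).partialY.toL2 B) atTop (𝓝 (weakD B 0 1 w)) := by
  have hpos : ∀ n : ℕ, (0 : ENNReal) < ((n : ENNReal) + 1)⁻¹ := fun n => by simp
  choose φ hφ hd h0 h1 h2 using fun n : ℕ => h.2 _ (hpos n)
  have hlim : Tendsto (fun n : ℕ => ((n : ENNReal) + 1)⁻¹) atTop (𝓝 0) := by
    have := (tendsto_add_atTop_iff_nat 1).2 ENNReal.tendsto_inv_nat_nhds_zero
    simpa using this
  have key : ∀ (ψ : ℕ → ℝ × ℝ → ℝ) (hψ : ∀ n, IsSmoothCompact (ψ n)) (g : L2 B),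
      (∀ n, eLpNorm (fun p => ψ n p - g p) 2 (volume.restrict (halfStrip B))
        < ((n : ENNReal) + 1)⁻¹) →
      Tendsto (fun n => (hψ n).toL2 B) atTop (𝓝 g) := by
    intro ψ hψ g hg
    rw [tendsto_iff_edist_tendsto_0]
    refine tendsto_of_tendsto_of_tendsto_of_le_of_le tendsto_const_nhds hlim
      (fun n => zero_le) fun n => ?_
    refine le_trans (le_of_eq ?_) (hg n).le
    rw [Lp.edist_def]
    refine eLpNorm_congr_ae ?_
    filter_upwards [(hψ n).coeFn_toL2 B] with p hp
    simp [hp]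
  exact ⟨φ, hφ, hd, key _ _ _ h0, key _ _ _ h1, key _ _ _ h2⟩

/-! ### Integration by parts -/

/-- A smooth cutoff that vanishes within `ε` of the boundary of the half-strip and equals `1` on
the part of the half-strip at distance at least `2ε` from the sides. -/
noncomputable def cutoff (B ε : ℝ) (p : ℝ × ℝ) : ℝ :=
  Real.smoothTransition (p.1 / ε - 1) *
    (Real.smoothTransition (p.2 / ε - 1) * Real.smoothTransition ((B - p.2) / ε - 1))

theorem contDiff_cutoff (B ε : ℝ) : ContDiff ℝ (⊤ : ℕ∞) (cutoff B ε) := by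
  unfold cutoff
  have h := @Real.smoothTransition.contDiff (⊤ : ℕ∞)
  refine (h.comp ?_).mul ((h.comp ?_).mul (h.comp ?_)) <;> fun_prop

theorem norm_cutoff_le_one (B ε : ℝ) (p : ℝ × ℝ) : ‖cutoff B ε p‖ ≤ 1 := by
  have h0 := Real.smoothTransition.nonneg
  have h1 := Real.smoothTransition.le_one
  unfold cutoff
  rw [Real.norm_of_nonneg (mul_nonneg (h0 _) (mul_nonneg (h0 _) (h0 _)))]
  exact mul_le_one₀ (h1 _) (mul_nonneg (h0 _) (h0 _)) (mul_le_one₀ (h1 _) (h0 _) (h1 _))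

theorem cutoff_eq_one {B ε : ℝ} (hε : 0 < ε) {p : ℝ × ℝ} (h1 : 2 * ε ≤ p.1) (h2 : 2 * ε ≤ p.2)
    (h3 : 2 * ε ≤ B - p.2) : cutoff B ε p = 1 := by
  have key : ∀ s : ℝ, 2 * ε ≤ s → Real.smoothTransition (s / ε - 1) = 1 := fun s hs =>
    Real.smoothTransition.one_of_one_le (by
      have : 2 ≤ s / ε := (le_div_iff₀ hε).2 hs
      linarith)
  simp [cutoff, key _ h1, key _ h2, key _ h3]

theorem tsupport_cutoff_subset {B ε : ℝ} (hε : 0 < ε) : tsupport (cutoff B ε) ⊆ halfStrip B := by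
  have hcl : IsClosed (Ici ε ×ˢ Icc ε (B - ε) : Set (ℝ × ℝ)) := isClosed_Ici.prod isClosed_Icc
  have hsub : (Ici ε ×ˢ Icc ε (B - ε) : Set (ℝ × ℝ)) ⊆ halfStrip B := by
    rintro p ⟨h1, h2, h3⟩
    simp only [mem_Ici] at h1
    exact ⟨lt_of_lt_of_le hε h1, lt_of_lt_of_le hε h2, by linarith⟩
  refine (closure_minimal (fun p hp => ?_) hcl).trans hsub
  have key : ∀ s : ℝ, Real.smoothTransition (s / ε - 1) ≠ 0 → ε ≤ s := by
    intro s hs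
    by_contra! hlt
    exact hs (Real.smoothTransition.zero_of_nonpos (by
      have : s / ε ≤ 1 := (div_le_one hε).2 hlt.le
      linarith))
  simp only [cutoff, Function.mem_support, ne_eq, mul_eq_zero, not_or] at hp
  have := key _ hp.2.2
  exact ⟨key _ hp.1, key _ hp.2.1, by linarith⟩

/-- For `x > 2ε` the only factor depending on `x` is locally `1`, however close `y` is to the
horizontal sides. This is why integration by parts in `x` needs information on the left side only.
-/
theorem partialX_cutoff_eq_zero {B ε : ℝ} (hε : 0 < ε) {p : ℝ × ℝ} (hp : 2 * ε < p.1) :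
    fderiv ℝ (cutoff B ε) p (1, 0) = 0 := by
  have h1 : HasDerivAt (fun s => cutoff B ε (s, p.2)) (fderiv ℝ (cutoff B ε) p (1, 0)) p.1 := by
    have h := ((contDiff_cutoff B ε).differentiable (by simp) (p.1, p.2)).hasFDerivAt
    exact h.comp_hasDerivAt p.1 ((hasDerivAt_id p.1).prodMk (hasDerivAt_const p.1 p.2))
  refine h1.unique ((hasDerivAt_const p.1
    (Real.smoothTransition (p.2 / ε - 1) * Real.smoothTransition ((B - p.2) / ε - 1))
    ).congr_of_eventuallyEq ?_)
  filter_upwards [lt_mem_nhds hp] with s hs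
  rw [cutoff, Real.smoothTransition.one_of_one_le, one_mul]
  have : 2 ≤ s / ε := (le_div_iff₀ hε).2 hs.le
  linarith

theorem partialY_cutoff_eq_zero {B ε : ℝ} (hε : 0 < ε) {p : ℝ × ℝ} (hp : 2 * ε < p.2)
    (hp' : 2 * ε < B - p.2) : fderiv ℝ (cutoff B ε) p (0, 1) = 0 := by
  have h1 : HasDerivAt (fun s => cutoff B ε (p.1, s)) (fderiv ℝ (cutoff B ε) p (0, 1)) p.2 := by
    have h := ((contDiff_cutoff B ε).differentiable (by simp) (p.1, p.2)).hasFDerivAt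
    exact h.comp_hasDerivAt p.2 ((hasDerivAt_const p.2 p.1).prodMk (hasDerivAt_id p.2))
  refine h1.unique ((hasDerivAt_const p.2 (Real.smoothTransition (p.1 / ε - 1))
    ).congr_of_eventuallyEq ?_)
  filter_upwards [lt_mem_nhds hp, gt_mem_nhds (by linarith : p.2 < B - 2 * ε)] with s hs hs'
  have h2 : 2 ≤ (B - s) / ε := (le_div_iff₀ hε).2 (by linarith)
  have h3 : 2 ≤ s / ε := (le_div_iff₀ hε).2 hs.le
  simp only [cutoff]
  rw [Real.smoothTransition.one_of_one_le (x := s / ε - 1) (by linarith),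
    Real.smoothTransition.one_of_one_le (x := (B - s) / ε - 1) (by linarith), mul_one, mul_one]

theorem tendsto_integral_cutoff_mul {B : ℝ} {ε : ℕ → ℝ} (hε : ∀ n, 0 < ε n)
    (hlim : Tendsto ε atTop (𝓝 0)) {F : ℝ × ℝ → ℝ} (hF : IntegrableOn F (halfStrip B)) :
    Tendsto (fun n => ∫ p in halfStrip B, cutoff B (ε n) p * F p) atTop
      (𝓝 (∫ p in halfStrip B, F p)) := by
  refine tendsto_integral_of_dominated_convergence (fun p => ‖F p‖) (fun n => ?_) hF.norm
    (fun n => Eventually.of_forall fun p => ?_) ?_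
  · exact (contDiff_cutoff B (ε n)).continuous.aestronglyMeasurable.mul hF.aestronglyMeasurable
  · rw [norm_mul]
    exact mul_le_of_le_one_left (norm_nonneg _) (norm_cutoff_le_one B (ε n) p)
  · filter_upwards [ae_restrict_mem (measurableSet_halfStrip B)] with p hp
    obtain ⟨h1, h2, h3⟩ := hp
    have h1 : 0 < p.1 := h1
    have hev : ∀ s : ℝ, 0 < s → ∀ᶠ n in atTop, 2 * ε n ≤ s := fun s hs => by
      filter_upwards [hlim.eventually (gt_mem_nhds (half_pos hs))] with n hn
      linarith
    refine tendsto_const_nhds.congr' ?_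
    filter_upwards [hev _ h1, hev _ h2, hev (B - p.2) (by linarith)] with n a b c
    rw [cutoff_eq_one (hε n) a b c, one_mul]

theorem integrableOn_mul_of_L2 {B : ℝ} (f : L2 B) {φ : ℝ × ℝ → ℝ} (hφ : IsSmoothCompact φ) :
    IntegrableOn (fun p => f p * φ p) (halfStrip B) :=
  (Lp.memLp f).integrable_mul (hφ.memLp _)

/-- If a first order weak derivative in direction `e` can be tested with functions supported in
the half-strip, it can be tested with all `φ` on whose support the cutoffs do not vary in the
direction `e`. -/
theorem integral_mul_fderiv_eq_of_cutoff {B : ℝ} {w g : L2 B} {e : ℝ × ℝ}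
    (hw : ∀ φ : ℝ × ℝ → ℝ, IsSmoothCompact φ → tsupport φ ⊆ halfStrip B →
      ∫ p in halfStrip B, w p * fderiv ℝ φ p e = - ∫ p in halfStrip B, g p * φ p)
    {φ : ℝ × ℝ → ℝ} (hφ : IsSmoothCompact φ) {δ : ℝ} (hδ : 0 < δ)
    (hcut : ∀ ε, 0 < ε → ε < δ → ∀ p ∈ halfStrip B, φ p * fderiv ℝ (cutoff B ε) p e = 0) :
    ∫ p in halfStrip B, w p * fderiv ℝ φ p e = - ∫ p in halfStrip B, g p * φ p := by
  -- The shift by `2` makes `ε n < δ` strict already at `n = 0`.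
  set ε : ℕ → ℝ := fun n => δ / (n + 2) with hεdef
  have hε : ∀ n, 0 < ε n := fun n => by positivity
  have hεδ : ∀ n, ε n < δ := fun n => by
    rw [hεdef]
    have : (0 : ℝ) ≤ n := Nat.cast_nonneg n
    exact div_lt_self hδ (by linarith)
  have hlim : Tendsto ε atTop (𝓝 0) :=
    tendsto_const_nhds.div_atTop (tendsto_atTop_add_const_right _ _ tendsto_natCast_atTop_atTop)
  have h1 := tendsto_integral_cutoff_mul hε hlim (integrableOn_mul_of_L2 w (hφ.fderiv_apply e))
  have h2 := (tendsto_integral_cutoff_mul hε hlim (integrableOn_mul_of_L2 g hφ)).neg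
  refine tendsto_nhds_unique h1 (h2.congr fun n => ?_)
  have h3 := hw _ (hφ.mul_left (contDiff_cutoff B (ε n)))
    ((tsupport_mul_subset_left (g := φ)).trans (tsupport_cutoff_subset (hε n)))
  calc - ∫ p in halfStrip B, cutoff B (ε n) p * (g p * φ p)
      = - ∫ p in halfStrip B, g p * (cutoff B (ε n) p * φ p) := by
        congr 2; funext p; ring
    _ = _ := h3.symm
    _ = _ := by
        refine setIntegral_congr_fun (measurableSet_halfStrip B) fun p hp => ?_
        have h4 := hcut (ε n) (hε n) (hεδ n) p hp
        have h5 : fderiv ℝ (fun p => cutoff B (ε n) p * φ p) p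
            = cutoff B (ε n) p • fderiv ℝ φ p + φ p • fderiv ℝ (cutoff B (ε n)) p :=
          fderiv_fun_mul ((contDiff_cutoff B (ε n)).differentiable (by simp) p)
            (hφ.differentiable p)
        simp only [h5, add_apply, smul_apply, smul_eq_mul,
          h4]
        ring

/-- By compactness, `d` attains a positive minimum on `tsupport φ ∩ C`, unless this set is empty. -/
theorem exists_pos_forall_eq_zero_of_disjoint {φ : ℝ × ℝ → ℝ} (hφ : HasCompactSupport φ)
    {C : Set (ℝ × ℝ)} (hC : IsClosed C) {d : ℝ × ℝ → ℝ} (hd : Continuous d)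
    (hpos : ∀ p ∈ C, p ∈ tsupport φ → 0 < d p) :
    ∃ δ > 0, ∀ p ∈ C, d p < δ → φ p = 0 := by
  have hK : IsCompact (tsupport φ ∩ C) := hφ.isCompact.inter_right hC
  rcases (tsupport φ ∩ C).eq_empty_or_nonempty with he | hne
  · refine ⟨1, one_pos, fun p hp _ => ?_⟩
    by_contra h
    exact (he ▸ (⟨subset_tsupport φ h, hp⟩ : p ∈ tsupport φ ∩ C) : p ∈ (∅ : Set (ℝ × ℝ)))
  · obtain ⟨q, hq, hmin⟩ := hK.exists_isMinOn hne hd.continuousOn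
    refine ⟨d q, hpos q hq.2 hq.1, fun p hp hlt => ?_⟩
    by_contra h
    exact absurd (hmin ⟨subset_tsupport φ h, hp⟩) (not_le.2 hlt)

theorem halfStrip_subset_closed (B : ℝ) : halfStrip B ⊆ Ici 0 ×ˢ Icc 0 B :=
  prod_mono Ioi_subset_Ici_self Ioo_subset_Icc_self

theorem HasWeakDeriv.integral_mul_partialX {B : ℝ} {w g : L2 B} (hw : HasWeakDeriv B 1 0 w g)
    {φ : ℝ × ℝ → ℝ} (hφ : IsSmoothCompact φ) (hd : Disjoint (tsupport φ) (leftSide B)) :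
    ∫ p in halfStrip B, w p * partialX φ p = - ∫ p in halfStrip B, g p * φ p := by
  obtain ⟨δ, hδ, hzero⟩ := exists_pos_forall_eq_zero_of_disjoint hφ.2
    (isClosed_Ici.prod isClosed_Icc : IsClosed (Ici (0 : ℝ) ×ˢ Icc (0 : ℝ) B)) continuous_fst
    (fun p hp hs => lt_of_le_of_ne hp.1 fun h =>
      disjoint_left.1 hd hs ⟨h.symm, hp.2⟩)
  -- The cutoff varies in `x` only up to `2ε`, so `ε < δ / 2` keeps this layer inside the region `x
  -- < δ` where `φ` vanishes.
  refine integral_mul_fderiv_eq_of_cutoff (e := (1, 0))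
    (fun ψ hψ hs => (hw ψ hψ hs).trans (by simp)) hφ (half_pos hδ) fun ε hε hεδ p hp => ?_
  by_cases h : p.1 < δ
  · rw [hzero p (halfStrip_subset_closed B hp) h, zero_mul]
  · rw [partialX_cutoff_eq_zero hε (by linarith), mul_zero]

theorem HasWeakDeriv.integral_mul_partialY {B : ℝ} {w g : L2 B} (hw : HasWeakDeriv B 0 1 w g)
    {φ : ℝ × ℝ → ℝ} (hφ : IsSmoothCompact φ) (hd : Disjoint (tsupport φ) (horizontalSides B)) :
    ∫ p in halfStrip B, w p * partialY φ p = - ∫ p in halfStrip B, g p * φ p := by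
  obtain ⟨δ, hδ, hzero⟩ := exists_pos_forall_eq_zero_of_disjoint hφ.2
    (isClosed_Ici.prod isClosed_Icc : IsClosed (Ici (0 : ℝ) ×ˢ Icc (0 : ℝ) B))
    (d := fun p => min p.2 (B - p.2)) (by fun_prop)
    (fun p hp hs => lt_min
      (lt_of_le_of_ne hp.2.1 fun h => disjoint_left.1 hd hs ⟨hp.1, Or.inl h.symm⟩)
      (sub_pos.2 <| lt_of_le_of_ne hp.2.2 fun h => disjoint_left.1 hd hs ⟨hp.1, Or.inr h⟩))
  refine integral_mul_fderiv_eq_of_cutoff (e := (0, 1))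
    (fun ψ hψ hs => (hw ψ hψ hs).trans (by simp)) hφ (half_pos hδ) fun ε hε hεδ p hp => ?_
  by_cases h : min p.2 (B - p.2) < δ
  · rw [hzero p (halfStrip_subset_closed B hp) h, zero_mul]
  · obtain ⟨h1, h2⟩ := le_min_iff.1 (not_lt.1 h)
    rw [partialY_cutoff_eq_zero hε (by linarith) (by linarith), mul_zero]

/-- Only `h` carries a boundary condition: it is approximated in `H¹` by test functions supported
away from the left side, and both inner products pass to the limit. -/
theorem HasWeakDeriv.inner_eq_neg_inner_x {B : ℝ} {w g h : L2 B} {Γ : Set (ℝ × ℝ)}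
    (hw : HasWeakDeriv B 1 0 w g) (hh : VanishesOn B Γ h) (hΓ : leftSide B ⊆ Γ) :
    inner ℝ g h = - inner ℝ w (weakD B 1 0 h) := by
  obtain ⟨φ, hφ, hd, h0, h1, -⟩ := hh.exists_seq
  have l1 : Tendsto (fun n => inner ℝ w ((hφ n).partialX.toL2 B)) atTop _ :=
    tendsto_const_nhds.inner h1
  have l2 : Tendsto (fun n => inner ℝ g ((hφ n).toL2 B)) atTop _ := tendsto_const_nhds.inner h0
  refine tendsto_nhds_unique l2 (l1.neg.congr fun n => ?_)
  rw [inner_toL2, inner_toL2, hw.integral_mul_partialX (hφ n) ((hd n).mono_right hΓ), neg_neg]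

theorem HasWeakDeriv.inner_eq_neg_inner_y {B : ℝ} {w g h : L2 B} {Γ : Set (ℝ × ℝ)}
    (hw : HasWeakDeriv B 0 1 w g) (hh : VanishesOn B Γ h) (hΓ : horizontalSides B ⊆ Γ) :
    inner ℝ g h = - inner ℝ w (weakD B 0 1 h) := by
  obtain ⟨φ, hφ, hd, h0, -, h1⟩ := hh.exists_seq
  have l1 : Tendsto (fun n => inner ℝ w ((hφ n).partialY.toL2 B)) atTop _ :=
    tendsto_const_nhds.inner h1
  have l2 : Tendsto (fun n => inner ℝ g ((hφ n).toL2 B)) atTop _ := tendsto_const_nhds.inner h0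
  refine tendsto_nhds_unique l2 (l1.neg.congr fun n => ?_)
  rw [inner_toL2, inner_toL2, hw.integral_mul_partialY (hφ n) ((hd n).mono_right hΓ), neg_neg]

/-! ### Dissipativity of the derivative in `x` -/

/-- Translation of a function by `s` in the direction of `x`. -/
def shiftX (s : ℝ) (φ : ℝ × ℝ → ℝ) : ℝ × ℝ → ℝ := fun p => φ (p - (s, 0))

theorem shiftX_zero (φ : ℝ × ℝ → ℝ) : shiftX 0 φ = φ := by
  funext p
  exact congrArg φ (sub_zero p)

namespace IsSmoothCompact

variable {φ ψ : ℝ × ℝ → ℝ}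

theorem shiftX (hφ : IsSmoothCompact φ) (s : ℝ) : IsSmoothCompact (shiftX s φ) :=
  ⟨hφ.1.comp (contDiff_id.sub contDiff_const),
    hφ.2.comp_homeomorph (Homeomorph.subRight ((s, 0) : ℝ × ℝ))⟩

theorem partialX_shiftX (hφ : IsSmoothCompact φ) (s : ℝ) :
    _root_.partialX (_root_.shiftX s φ) = _root_.shiftX s (_root_.partialX φ) := by
  funext p
  refine ((hφ.shiftX s).hasDerivAt_x p.1 p.2).unique ?_
  have h := (hφ.hasDerivAt_x (p.1 - s) p.2).comp_sub_const p.1 s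
  simpa [_root_.shiftX, Prod.sub_def] using h

theorem tsupport_shiftX_subset {B s : ℝ} (hs : 0 ≤ s) (h : tsupport φ ⊆ halfStrip B) :
    tsupport (_root_.shiftX s φ) ⊆ halfStrip B := by
  have h1 : tsupport (_root_.shiftX s φ) ⊆ (fun p => p - ((s, 0) : ℝ × ℝ)) ⁻¹' tsupport φ :=
    tsupport_comp_subset_preimage φ (f := fun p => p - ((s, 0) : ℝ × ℝ)) (by fun_prop)
  intro p hp
  obtain ⟨h2, h3⟩ := h (h1 hp)
  simp only [Prod.fst_sub, Prod.snd_sub, mem_Ioi, sub_zero] at h2 h3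
  exact ⟨by simp only [mem_Ioi]; linarith, h3⟩

/-- Translation is an isometry of `L²(ℝ²)`, and restriction to the half-strip can only lose mass. -/
theorem norm_toL2_shiftX_le {B s : ℝ} (hφ : IsSmoothCompact φ) (h : tsupport φ ⊆ halfStrip B) :
    ‖(hφ.shiftX s).toL2 B‖ ≤ ‖hφ.toL2 B‖ := by
  rw [toL2, toL2, Lp.norm_toLp, Lp.norm_toLp]
  refine ENNReal.toReal_mono (hφ.memLp _).2.ne ?_
  have h1 : eLpNorm (_root_.shiftX s φ) 2 volume = eLpNorm φ 2 volume :=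
    eLpNorm_comp_measurePreserving hφ.continuous.aestronglyMeasurable
      (measurePreserving_sub_right volume ((s, 0) : ℝ × ℝ))
  have h2 : eLpNorm φ 2 (volume.restrict (halfStrip B)) = eLpNorm φ 2 volume := by
    rw [← eLpNorm_indicator_eq_eLpNorm_restrict (measurableSet_halfStrip B),
      indicator_eq_self.2 ((subset_tsupport φ).trans h)]
  rw [h2, ← h1]
  exact eLpNorm_mono_measure _ Measure.restrict_le_self

theorem hasDerivAt_inner_toL2_shiftX {B : ℝ} (hφ : IsSmoothCompact φ) (w : L2 B) (r : ℝ) :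
    HasDerivAt (fun s => inner ℝ w ((hφ.shiftX s).toL2 B))
      (- ∫ p in halfStrip B, w p * _root_.partialX (_root_.shiftX r φ) p) r := by
  simp only [inner_toL2]
  obtain ⟨C, hC⟩ := hφ.partialX.2.exists_bound_of_continuous hφ.partialX.continuous
  obtain ⟨R, hR⟩ := hφ.partialX.2.isCompact.isBounded.subset_closedBall 0
  -- This ball contains the supports of all translates of `∂ₓφ` by `s` with `|s - r| < 1`, so one
  -- integrable bound serves for all of them.
  set K : Set (ℝ × ℝ) := Metric.closedBall 0 (R + (|r| + 1))
  have hK : IsCompact K := isCompact_closedBall _ _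
  have hbound : Integrable (fun p => K.indicator (fun p => C * ‖w p‖) p)
      (volume.restrict (halfStrip B)) := by
    rw [integrable_indicator_iff hK.measurableSet]
    have hloc : LocallyIntegrable w (volume.restrict (halfStrip B)) :=
      (Lp.memLp w).locallyIntegrable (by norm_num)
    exact (hloc.integrableOn_isCompact hK).norm.const_mul C
  rw [← integral_neg]
  refine (hasDerivAt_integral_of_dominated_loc_of_deriv_le
    (F := fun s p => w p * _root_.shiftX s φ p)
    (F' := fun s p => - (w p * _root_.partialX (_root_.shiftX s φ) p))
    (Metric.ball_mem_nhds r one_pos)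
    (Eventually.of_forall fun s => (integrableOn_mul_of_L2 w (hφ.shiftX s)).aestronglyMeasurable)
    (integrableOn_mul_of_L2 w (hφ.shiftX r))
    (integrableOn_mul_of_L2 w (hφ.shiftX r).partialX).neg.aestronglyMeasurable
    (Eventually.of_forall fun p s hs => ?_) hbound
    (Eventually.of_forall fun p s hs => ?_)).2
  · have hs' : |s| ≤ |r| + 1 := by
      have h1 : |s - r| < 1 := hs
      have h2 : |s| ≤ |s - r| + |r| := by simpa using abs_add_le (s - r) r
      linarith
    simp only [hφ.partialX_shiftX, norm_neg, norm_mul, _root_.shiftX]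
    by_cases hp : p ∈ K
    · rw [indicator_of_mem hp, mul_comm]
      exact mul_le_mul_of_nonneg_right (hC _) (norm_nonneg _)
    · rw [indicator_of_notMem hp]
      have h0 : _root_.partialX φ (p - (s, 0)) = 0 := by
        by_contra hne
        have h1 := hR (subset_tsupport _ hne)
        apply hp
        rw [mem_closedBall_zero_iff] at h1 ⊢
        have h2 : ‖((s, 0) : ℝ × ℝ)‖ = |s| := by simp [Prod.norm_def]
        have h3 : ‖p‖ ≤ ‖p - (s, 0)‖ + ‖((s, 0) : ℝ × ℝ)‖ := by
          have h4 := norm_add_le (p - (s, 0)) ((s, 0) : ℝ × ℝ)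
          rwa [sub_add_cancel] at h4
        linarith
      rw [h0, norm_zero, mul_zero]
  · have h1 := (hφ.hasDerivAt_x (p.1 - s) p.2).comp_const_sub p.1 s
    have h2 := h1.const_mul (w p)
    rw [hφ.partialX_shiftX]
    simpa [_root_.shiftX, Prod.sub_def] using h2

end IsSmoothCompact

namespace HasWeakDeriv

variable {B : ℝ} {w g : L2 B} {φ : ℝ × ℝ → ℝ}

/-- Right translation keeps supports inside the half-strip, so the weak derivative may be tested
with every translate. In semigroup terms, `∂ₓ` generates the adjoint of the right translations. -/
theorem hasDerivAt_inner_shiftX (hw : HasWeakDeriv B 1 0 w g) (hφ : IsSmoothCompact φ)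
    (hs : tsupport φ ⊆ halfStrip B) {r : ℝ} (hr : 0 ≤ r) :
    HasDerivAt (fun s => inner ℝ w ((hφ.shiftX s).toL2 B))
      (inner ℝ g ((hφ.shiftX r).toL2 B)) r := by
  have h1 := hφ.hasDerivAt_inner_toL2_shiftX w r
  have h2 := hw _ (hφ.shiftX r) (IsSmoothCompact.tsupport_shiftX_subset hr hs)
  have h3 : ∫ p in halfStrip B, w p * partialX (shiftX r φ) p
      = - ∫ p in halfStrip B, g p * shiftX r φ p := h2.trans (by simp)
  rwa [h3, neg_neg, ← inner_toL2 g (hφ.shiftX r)] at h1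

theorem abs_inner_shiftX_sub_le (hw : HasWeakDeriv B 1 0 w g) (hφ : IsSmoothCompact φ)
    (hs : tsupport φ ⊆ halfStrip B) {s : ℝ} (hs0 : 0 ≤ s) :
    |inner ℝ w ((hφ.shiftX s).toL2 B) - inner ℝ w (hφ.toL2 B)| ≤ ‖g‖ * ‖hφ.toL2 B‖ * s := by
  have h := norm_image_sub_le_of_norm_deriv_le_segment' (a := 0) (b := s)
    (f := fun s => inner ℝ w ((hφ.shiftX s).toL2 B)) (C := ‖g‖ * ‖hφ.toL2 B‖)
    (fun r hr => (hw.hasDerivAt_inner_shiftX hφ hs hr.1).hasDerivWithinAt)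
    (fun r hr => (norm_inner_le_norm _ _).trans
      (mul_le_mul_of_nonneg_left (hφ.norm_toL2_shiftX_le hs) (norm_nonneg _)))
    s (right_mem_Icc.2 hs0)
  simpa only [shiftX_zero, sub_zero, Real.norm_eq_abs] using h

/-- On the half-strip, `∂ₓ` is dissipative: `(w_x, w) ≤ 0`, without any boundary condition. -/
theorem inner_nonpos (hw : HasWeakDeriv B 1 0 w g) : inner ℝ g w ≤ 0 := by
  obtain ⟨φ, hφ, hsupp, hlim⟩ := exists_test_seq w
  have hshift : ∀ n s, 0 ≤ s →
      inner ℝ w (((hφ n).shiftX s).toL2 B) - inner ℝ w ((hφ n).toL2 B)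
        ≤ ‖g‖ * ‖w - (hφ n).toL2 B‖ * s := by
    intro n s hs
    -- The contraction property bounds the increment for `φ m` by `‖w‖ ‖φ m‖ - (w, φ m)`, which
    -- tends to `0`; replacing `φ m` by `φ n` costs at most `‖g‖ ‖φ m - φ n‖ s`. The limit in `m`
    -- leaves a bound proportional to `s`, which survives division by `s`.
    have hl : Tendsto (fun m => ‖w‖ * ‖(hφ m).toL2 B‖ - inner ℝ w ((hφ m).toL2 B)
        + ‖g‖ * ‖(hφ m).toL2 B - (hφ n).toL2 B‖ * s) atTop
        (𝓝 (‖w‖ * ‖w‖ - inner ℝ w w + ‖g‖ * ‖w - (hφ n).toL2 B‖ * s)) :=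
      ((hlim.norm.const_mul _).sub (tendsto_const_nhds.inner hlim)).add
        (((hlim.sub_const _).norm.const_mul _).mul_const _)
    rw [real_inner_self_eq_norm_mul_norm, sub_self, zero_add] at hl
    refine ge_of_tendsto' hl fun m => ?_
    have h1 := hw.abs_inner_shiftX_sub_le ((hφ m).sub (hφ n))
      ((tsupport_sub _ _).trans (union_subset (hsupp m) (hsupp n))) hs
    have h3 : (((hφ m).sub (hφ n)).shiftX s).toL2 B
        = ((hφ m).shiftX s).toL2 B - ((hφ n).shiftX s).toL2 B := rfl
    rw [h3, IsSmoothCompact.toL2_sub (hφ m) (hφ n), inner_sub_right, inner_sub_right] at h1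
    have h4 := (abs_le.1 h1).1
    have h5 : inner ℝ w (((hφ m).shiftX s).toL2 B) ≤ ‖w‖ * ‖(hφ m).toL2 B‖ :=
      (real_inner_le_norm _ _).trans
        (mul_le_mul_of_nonneg_left ((hφ m).norm_toL2_shiftX_le (hsupp m)) (norm_nonneg _))
    linarith
  have hderiv : ∀ n, inner ℝ g ((hφ n).toL2 B) ≤ ‖g‖ * ‖w - (hφ n).toL2 B‖ := by
    intro n
    have h1 := (hw.hasDerivAt_inner_shiftX (hφ n) (hsupp n) le_rfl).tendsto_slope_zero_right
    simp only [shiftX_zero, zero_add, smul_eq_mul] at h1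
    refine le_of_tendsto h1 ?_
    filter_upwards [self_mem_nhdsWithin] with s hs
    have hs : 0 < s := hs
    rw [inv_mul_le_iff₀ hs, mul_comm s]
    exact hshift n s hs.le
  have hr : Tendsto (fun n => ‖g‖ * ‖w - (hφ n).toL2 B‖) atTop (𝓝 (‖g‖ * ‖w - w‖)) :=
    ((hlim.const_sub w).norm).const_mul _
  rw [sub_self, norm_zero, mul_zero] at hr
  exact le_of_tendsto_of_tendsto' (tendsto_const_nhds.inner hlim) hr hderiv

end HasWeakDeriv

/-! ### The sharp Poincaré inequality in `y` -/

theorem inner_toL2_toL2 {B : ℝ} {φ ψ : ℝ × ℝ → ℝ} (hφ : IsSmoothCompact φ)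
    (hψ : IsSmoothCompact ψ) :
    inner ℝ (hφ.toL2 B) (hψ.toL2 B) = ∫ p in halfStrip B, φ p * ψ p := by
  rw [inner_toL2]
  refine integral_congr_ae ?_
  filter_upwards [hφ.coeFn_toL2 B] with p hp
  rw [hp]

/-- Wirtinger's inequality on `(0, B)` for functions vanishing near the end points. -/
theorem wirtinger_of_eventuallyEq_zero {B : ℝ} (hB : 0 < B) {ψ ψ' : ℝ → ℝ}
    (hψ : ∀ y, HasDerivAt ψ (ψ' y) y) (hψ' : Continuous ψ')
    (h0 : ψ =ᶠ[𝓝 0] 0) (h1 : ψ =ᶠ[𝓝 B] 0) :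
    0 ≤ ∫ y in Ioo 0 B, (ψ' y ^ 2 - (Real.pi / B) ^ 2 * ψ y ^ 2) := by
  set a := Real.pi / B
  have hψc : Continuous ψ := continuous_iff_continuousAt.2 fun y => (hψ y).continuousAt
  -- With `F = a cot(ay) ψ²`, the integrand minus `F'` is the square `(ψ' - a cot(ay) ψ)²`, and `F`
  -- vanishes at both end points. The singularities of the cotangent are harmless because `ψ`
  -- vanishes near them.
  set F : ℝ → ℝ := fun y => a * (Real.cos (a * y) / Real.sin (a * y)) * ψ y ^ 2 with hF
  have hsin : ∀ y ∈ Ioo 0 B, Real.sin (a * y) ≠ 0 := by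
    intro y hy
    refine (Real.sin_pos_of_pos_of_lt_pi (mul_pos (div_pos Real.pi_pos hB) hy.1) ?_).ne'
    rw [div_mul_eq_mul_div, div_lt_iff₀ hB]
    exact mul_lt_mul_of_pos_left hy.2 Real.pi_pos
  have hderiv : ∀ y ∈ Ioo 0 B, HasDerivAt F
      (a * ((-Real.sin (a * y) * a * Real.sin (a * y) - Real.cos (a * y) * (Real.cos (a * y) * a))
        / Real.sin (a * y) ^ 2) * ψ y ^ 2
        + a * (Real.cos (a * y) / Real.sin (a * y)) * (2 * ψ y * ψ' y)) y := by
    intro y hy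
    have hl : HasDerivAt (fun y => a * y) a y := by simpa using (hasDerivAt_id y).const_mul a
    have h2 : HasDerivAt (fun y => ψ y ^ 2) (2 * ψ y * ψ' y) y := by
      simpa [Pi.pow_def] using (hψ y).pow 2
    exact ((hl.cos.div hl.sin (hsin y hy)).const_mul a).mul h2
  have hF0 : ∀ z, ψ =ᶠ[𝓝 z] 0 → F =ᶠ[𝓝 z] 0 := fun z hz => by
    filter_upwards [hz] with y hy
    simp [hF, hy]
  have hcont : ContinuousOn F (Icc 0 B) := by
    intro y hy
    rcases eq_or_lt_of_le hy.1 with rfl | hy0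
    · exact (continuousAt_const.congr (hF0 0 h0).symm).continuousWithinAt
    rcases eq_or_lt_of_le hy.2 with rfl | hyB
    · exact (continuousAt_const.congr (hF0 y h1).symm).continuousWithinAt
    · exact (hderiv y ⟨hy0, hyB⟩).continuousAt.continuousWithinAt
  have hint : Continuous fun y => ψ' y ^ 2 - a ^ 2 * ψ y ^ 2 := by fun_prop
  have key := intervalIntegral.sub_le_integral_of_hasDeriv_right_of_le hB.le hcont
    (fun y hy => (hderiv y hy).hasDerivWithinAt) (hint.integrableOn_Icc) (fun y hy => ?_)
  · rw [(hF0 0 h0).self_of_nhds, (hF0 B h1).self_of_nhds,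
      intervalIntegral.integral_of_le hB.le, integral_Ioc_eq_integral_Ioo] at key
    simpa using key
  · have hs := hsin y hy
    set s := Real.sin (a * y)
    set c := Real.cos (a * y)
    have hcs : c ^ 2 = 1 - s ^ 2 := Real.cos_sq' _
    have h2 : (-s * a * s - c * (c * a)) / s ^ 2 = -a * (1 + (c / s) ^ 2) := by
      field_simp
      ring
    have h3 : (c / s) ^ 2 = 1 / s ^ 2 - 1 := by
      field_simp
      exact hcs
    rw [h2]
    nlinarith [sq_nonneg (ψ' y - a * (c / s) * ψ y)]

theorem integrableOn_mul {B : ℝ} {φ ψ : ℝ × ℝ → ℝ} (hφ : IsSmoothCompact φ)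
    (hψ : IsSmoothCompact ψ) : IntegrableOn (fun p => φ p * ψ p) (halfStrip B) :=
  (hφ.memLp _).integrable_mul (hψ.memLp _)

/-- Wirtinger's inequality on each segment `x = const`, integrated over `x > 0`. -/
theorem IsSmoothCompact.norm_sq_toL2_le_partialY {B : ℝ} (hB : 0 < B) {φ : ℝ × ℝ → ℝ}
    (hφ : IsSmoothCompact φ) (hd : Disjoint (tsupport φ) (horizontalSides B)) :
    (Real.pi / B) ^ 2 * ‖hφ.toL2 B‖ ^ 2 ≤ ‖hφ.partialY.toL2 B‖ ^ 2 := by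
  rw [← real_inner_self_eq_norm_sq, ← real_inner_self_eq_norm_sq, inner_toL2_toL2,
    inner_toL2_toL2, ← sub_nonneg, ← integral_const_mul,
    ← integral_sub (integrableOn_mul hφ.partialY hφ.partialY)
      ((integrableOn_mul hφ hφ).const_mul _)]
  have hint : IntegrableOn (fun p => _root_.partialY φ p * _root_.partialY φ p
      - (Real.pi / B) ^ 2 * (φ p * φ p)) (Ioi 0 ×ˢ Ioo 0 B) (volume.prod volume) :=
    (integrableOn_mul hφ.partialY hφ.partialY).sub ((integrableOn_mul hφ hφ).const_mul _)
  have h := setIntegral_prod _ hint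
  rw [halfStrip, Measure.volume_eq_prod, h]
  refine setIntegral_nonneg measurableSet_Ioi fun x hx => ?_
  have hnear : ∀ z ∈ ({0, B} : Set ℝ), (fun y => φ (x, y)) =ᶠ[𝓝 z] 0 := by
    intro z hz
    have h1 : (x, z) ∉ tsupport φ := fun hmem => disjoint_left.1 hd hmem ⟨(le_of_lt hx : (0 : ℝ) ≤ x), hz⟩
    have h2 := notMem_tsupport_iff_eventuallyEq.1 h1
    exact (Continuous.tendsto (f := fun y : ℝ => (x, y)) (by fun_prop) z).eventually h2
  have h3 := wirtinger_of_eventuallyEq_zero hB (fun y => hφ.hasDerivAt_y x y)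
    (hφ.partialY.continuous.comp (by fun_prop : Continuous fun y : ℝ => (x, y)))
    (hnear 0 (by simp)) (hnear B (by simp))
  simpa only [pow_two] using h3

theorem VanishesOn.norm_sq_le {B : ℝ} (hB : 0 < B) {Γ : Set (ℝ × ℝ)} {h : L2 B}
    (hh : VanishesOn B Γ h) (hΓ : horizontalSides B ⊆ Γ) :
    (Real.pi / B) ^ 2 * ‖h‖ ^ 2 ≤ ‖weakD B 0 1 h‖ ^ 2 := by
  obtain ⟨φ, hφ, hd, h0, -, h1⟩ := hh.exists_seq
  exact le_of_tendsto_of_tendsto' ((h0.norm.pow 2).const_mul _) (h1.norm.pow 2)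
    fun n => (hφ n).norm_sq_toL2_le_partialY hB ((hd n).mono_right hΓ)

/-! ### The nonlinear term -/

/-- The integrand is `∂ₓ(G(φ))` for a primitive `G` of `g`, and on each horizontal line `φ` vanishes
at `x = 0` and for large `x`. -/
theorem IsSmoothCompact.integral_comp_mul_partialX_eq_zero {B : ℝ} {φ : ℝ × ℝ → ℝ}
    (hφ : IsSmoothCompact φ) (hd : Disjoint (tsupport φ) (leftSide B)) {g : ℝ → ℝ}
    (hg : Continuous g) :
    ∫ p in halfStrip B, g (φ p) * _root_.partialX φ p = 0 := by
  have hc : Continuous fun p => g (φ p) * _root_.partialX φ p :=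
    (hg.comp hφ.continuous).mul hφ.partialX.continuous
  have hint : Integrable (fun p => g (φ p) * _root_.partialX φ p) (volume.prod volume) :=
    hc.integrable_of_hasCompactSupport hφ.partialX.2.mul_left
  have h1 := setIntegral_prod_swap (μ := volume) (ν := volume) (Ioi (0 : ℝ)) (Ioo 0 B)
    (fun p => g (φ p) * _root_.partialX φ p)
  -- Swapping the coordinates makes `x` the inner variable of integration.
  rw [halfStrip, Measure.volume_eq_prod, ← h1, setIntegral_prod (fun z : ℝ × ℝ => g (φ z.swap) * _root_.partialX φ z.swap)
    hint.swap.integrableOn]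
  refine setIntegral_eq_zero_of_forall_eq_zero fun y hy => ?_
  set G : ℝ → ℝ := fun s => ∫ r in (0 : ℝ)..s, g r
  have hG : ∀ s, HasDerivAt G (g s) s := fun s => (hg.integral_hasStrictDerivAt 0 s).hasDerivAt
  have hemb : Topology.IsClosedEmbedding fun x : ℝ => (x, y) :=
    (Isometry.of_dist_eq fun a b => by simp [Prod.dist_eq]).isClosedEmbedding
  have hslice : HasCompactSupport fun x => φ (x, y) := hφ.2.comp_isClosedEmbedding hemb
  have hderiv : ∀ x, HasDerivAt (fun x => G (φ (x, y)))
      (g (φ (x, y)) * _root_.partialX φ (x, y)) x := fun x =>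
    (hG (φ (x, y))).comp x (h := fun s => φ (s, y)) (hφ.hasDerivAt_x x y)
  have hlim : Tendsto (fun x => G (φ (x, y))) atTop (𝓝 (G 0)) :=
    (hG 0).continuousAt.tendsto.comp ((hslice.is_zero_at_infty).mono_left atTop_le_cocompact)
  have h0 : φ (0, y) = 0 := by
    by_contra hne
    exact disjoint_left.1 hd (subset_tsupport φ hne) ⟨rfl, hy.1.le, hy.2.le⟩
  have h2 := integral_Ioi_of_hasDerivAt_of_tendsto (hderiv 0).continuousAt.continuousWithinAt
    (fun x _ => hderiv x) (Continuous.integrable_of_hasCompactSupport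
      (hc.comp (by fun_prop : Continuous fun x : ℝ => (x, y)))
      (hφ.partialX.2.mul_left.comp_isClosedEmbedding hemb)).integrableOn hlim
  simpa [h0] using h2

/-- A bounded Lipschitz truncation of the square. -/
noncomputable def truncSq (M s : ℝ) : ℝ := min |s| M ^ 2

theorem truncSq_le_sq {M : ℝ} (hM : 0 ≤ M) (s : ℝ) : truncSq M s ≤ s ^ 2 := by
  rw [← sq_abs s]
  exact pow_le_pow_left₀ (le_min (abs_nonneg s) hM) (min_le_left _ _) 2

theorem truncSq_nonneg (M s : ℝ) : 0 ≤ truncSq M s := sq_nonneg _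

theorem lipschitzWith_truncSq (M : NNReal) : LipschitzWith (2 * M) (truncSq M) := by
  refine LipschitzWith.of_dist_le_mul fun s t => ?_
  rw [Real.dist_eq, Real.dist_eq, truncSq, truncSq, sq_sub_sq, abs_mul]
  have h1 : |min |s| (M : ℝ) - min |t| M| ≤ |s - t| := by
    refine (abs_min_sub_min_le_max _ _ _ _).trans ?_
    rw [sub_self, abs_zero, max_eq_left (abs_nonneg _)]
    exact abs_abs_sub_abs_le s t
  have h2 : ∀ r : ℝ, 0 ≤ min |r| (M : ℝ) := fun r => le_min (abs_nonneg r) M.2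
  have h3 : |min |s| (M : ℝ) + min |t| M| ≤ 2 * M := by
    rw [abs_of_nonneg (add_nonneg (h2 s) (h2 t))]
    linarith [min_le_right |s| (M : ℝ), min_le_right |t| (M : ℝ)]
  push_cast
  exact mul_le_mul h3 h1 (abs_nonneg _) (by positivity)

/-- `∫ f² f_x = 0` if the trace of `f` vanishes on the left side. -/
theorem VanishesOn.inner_eq_zero_of_eq_mul {B : ℝ} {Γ : Set (ℝ × ℝ)} {f N : L2 B}
    (hf : VanishesOn B Γ f) (hΓ : leftSide B ⊆ Γ)
    (hN : ∀ᵐ p ∂volume.restrict (halfStrip B), N p = f p * weakD B 1 0 f p) :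
    inner ℝ N f = 0 := by
  -- Squaring is not continuous from `L²` to `L²`, but composition with the Lipschitz function
  -- `truncSq M` is, so the identity for test functions passes to the limit. The truncation is
  -- removed afterwards, with the integrable dominating function `|N f| = f² |f_x|`.
  have htrunc : ∀ M : ℕ, ∫ p in halfStrip B, truncSq M (f p) * weakD B 1 0 f p = 0 := by
    intro M
    obtain ⟨φ, hφ, hd, h0, h1, -⟩ := hf.exists_seq
    have hL := lipschitzWith_truncSq (M : NNReal)
    have hz : truncSq (M : NNReal) 0 = 0 := by simp [truncSq]
    have hl := ((hL.continuous_compLp (p := 2) (μ := volume.restrict (halfStrip B)) hz).tendsto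
      f).comp h0
    have hlim := Filter.Tendsto.inner (𝕜 := ℝ) hl h1
    have hzero : ∀ n, inner ℝ (hL.compLp hz ((hφ n).toL2 B)) ((hφ n).partialX.toL2 B) = 0 := by
      intro n
      rw [inner_toL2, ← (hφ n).integral_comp_mul_partialX_eq_zero ((hd n).mono_right hΓ)
        hL.continuous]
      refine integral_congr_ae ?_
      filter_upwards [hL.coeFn_compLp hz ((hφ n).toL2 B), (hφ n).coeFn_toL2 B] with p hp hp'
      rw [hp, Function.comp_apply, hp']
    have h2 : inner ℝ (hL.compLp hz f) (weakD B 1 0 f) = 0 :=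
      tendsto_nhds_unique hlim (tendsto_const_nhds.congr fun n => (hzero n).symm)
    rw [← h2, inner_eq_integral]
    refine integral_congr_ae ?_
    filter_upwards [hL.coeFn_compLp hz f] with p hp
    rw [hp]
    simp
  have hint : Integrable (fun p => N p * f p) (volume.restrict (halfStrip B)) :=
    (Lp.memLp N).integrable_mul (Lp.memLp f)
  have hlim : Tendsto (fun M : ℕ => ∫ p in halfStrip B, truncSq M (f p) * weakD B 1 0 f p)
      atTop (𝓝 (∫ p in halfStrip B, N p * f p)) := by
    refine tendsto_integral_of_dominated_convergence (fun p => ‖N p * f p‖) (fun M => ?_)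
      hint.norm (fun M => ?_) ?_
    · exact ((lipschitzWith_truncSq (M : NNReal)).continuous.comp_aestronglyMeasurable
        (Lp.aestronglyMeasurable f)).mul (Lp.aestronglyMeasurable _)
    · filter_upwards [hN] with p hp
      rw [hp, show f p * weakD B 1 0 f p * f p = f p ^ 2 * weakD B 1 0 f p by ring, norm_mul,
        norm_mul, Real.norm_of_nonneg (truncSq_nonneg _ _), Real.norm_of_nonneg (sq_nonneg _)]
      exact mul_le_mul_of_nonneg_right (truncSq_le_sq (Nat.cast_nonneg M) _) (norm_nonneg _)
    · filter_upwards [hN] with p hp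
      refine tendsto_const_nhds.congr' ?_
      filter_upwards [tendsto_natCast_atTop_atTop.eventually_ge_atTop |f p|] with M hM
      rw [hp, truncSq, min_eq_left hM, sq_abs]
      ring
  rw [inner_eq_integral]
  exact tendsto_nhds_unique hlim (tendsto_const_nhds.congr fun M => (htrunc M).symm)

/-! ### The energy inequality -/

theorem leftSide_subset (B : ℝ) : leftSide B ⊆ leftSide B ∪ horizontalSides B := subset_union_left

theorem horizontalSides_subset (B : ℝ) : horizontalSides B ⊆ leftSide B ∪ horizontalSides B :=
  subset_union_right

theorem MemH.hasWeakDeriv {B : ℝ} {m i j : ℕ} {f : L2 B} (hf : MemH B m f) (hij : i + j ≤ m) :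
    HasWeakDeriv B i j f (weakD B i j f) := hasWeakDeriv_weakD (hf i j hij)

section Energy

variable {B : ℝ} {f : L2 B}

theorem inner_bilaplacian_self (hf : MemH B 4 f) (hb : BoundaryConditions B f) :
    inner ℝ (bilaplacian B f) f = ‖laplacian B f‖ ^ 2 := by
  have d : ∀ {i j : ℕ}, i + j ≤ 4 → HasWeakDeriv B i j f (weakD B i j f) := hf.hasWeakDeriv
  have d10 := d (i := 1) (j := 0) (by norm_num)
  have d20 := d (i := 2) (j := 0) (by norm_num)
  have d30 := d (i := 3) (j := 0) (by norm_num)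
  have d40 := d (i := 4) (j := 0) (by norm_num)
  have d01 := d (i := 0) (j := 1) (by norm_num)
  have d02 := d (i := 0) (j := 2) (by norm_num)
  have d03 := d (i := 0) (j := 3) (by norm_num)
  have d04 := d (i := 0) (j := 4) (by norm_num)
  have d12 := d (i := 1) (j := 2) (by norm_num)
  have d22 := d (i := 2) (j := 2) (by norm_num)
  have e1 := (d30.succ_x d40).inner_eq_neg_inner_x hb.zero (leftSide_subset B)
  have e2 := (d20.succ_x d30).inner_eq_neg_inner_x hb.dx subset_rfl
  have e3 := (d12.succ_x d22).inner_eq_neg_inner_x hb.zero (leftSide_subset B)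
  have e4 := (d02.succ_x d12).inner_eq_neg_inner_x hb.dx subset_rfl
  have e5 := (d03.succ_y d04).inner_eq_neg_inner_y hb.zero (horizontalSides_subset B)
  -- On the horizontal sides `f_y` need not vanish, so the second integration by parts in `y` starts
  -- from `(f_yy, f_yy)` and uses the vanishing trace of `f_yy`.
  have e6 := (d01.succ_y d02).inner_eq_neg_inner_y hb.dyy subset_rfl
  rw [(d10.succ_x d20).weakD_eq] at e2 e4
  rw [(d02.succ_y d03).weakD_eq] at e6
  rw [← real_inner_self_eq_norm_sq, bilaplacian, laplacian]
  simp only [inner_add_left, inner_add_right, real_inner_smul_left]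
  rw [e1, e2, e3, e4, e5, real_inner_comm (weakD B 2 0 f) (weakD B 0 2 f), e6,
    real_inner_comm (weakD B 0 3 f)]
  ring

theorem inner_laplacian_self (hf : MemH B 2 f) (hb : BoundaryConditions B f) :
    inner ℝ (laplacian B f) f = -(‖weakD B 1 0 f‖ ^ 2 + ‖weakD B 0 1 f‖ ^ 2) := by
  have d : ∀ {i j : ℕ}, i + j ≤ 2 → HasWeakDeriv B i j f (weakD B i j f) := hf.hasWeakDeriv
  have e1 := ((d (i := 1) (j := 0) (by norm_num)).succ_x
    (d (by norm_num))).inner_eq_neg_inner_x hb.zero (leftSide_subset B)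
  have e2 := ((d (i := 0) (j := 1) (by norm_num)).succ_y
    (d (by norm_num))).inner_eq_neg_inner_y hb.zero (horizontalSides_subset B)
  rw [laplacian, inner_add_left, e1, e2, real_inner_self_eq_norm_sq, real_inner_self_eq_norm_sq]
  ring

/-- One integration by parts in each term leaves `-(f_xx, f_x) - (f_xy, f_y)`, to which
dissipativity applies with `w = f_x` and `w = f_y`. -/
theorem inner_laplacianDx_self_nonneg (hf : MemH B 3 f) (hb : BoundaryConditions B f) :
    0 ≤ inner ℝ (laplacianDx B f) f := by
  have d : ∀ {i j : ℕ}, i + j ≤ 3 → HasWeakDeriv B i j f (weakD B i j f) := hf.hasWeakDeriv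
  have d10 := d (i := 1) (j := 0) (by norm_num)
  have d20 := d (i := 2) (j := 0) (by norm_num)
  have d30 := d (i := 3) (j := 0) (by norm_num)
  have d01 := d (i := 0) (j := 1) (by norm_num)
  have d11 := d (i := 1) (j := 1) (by norm_num)
  have d12 := d (i := 1) (j := 2) (by norm_num)
  have e1 := (d20.succ_x d30).inner_eq_neg_inner_x hb.zero (leftSide_subset B)
  have e2 := (d11.succ_y d12).inner_eq_neg_inner_y hb.zero (horizontalSides_subset B)
  have e3 := (d10.succ_x d20).inner_nonpos
  have e4 := (d01.succ_x d11).inner_nonpos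
  rw [laplacianDx, inner_add_left, e1, e2]
  linarith

/-- Two integrations by parts, using the zero traces of `f` and `f_x`, give `(f_xxx, f_xx)`, which
has the form `(w_x, w)`. -/
theorem inner_weakD_five_self_nonpos (hf : MemH B 4 f)
    (hf5 : ∃ g : L2 B, HasWeakDeriv B 5 0 f g) (hb : BoundaryConditions B f) :
    inner ℝ (weakD B 5 0 f) f ≤ 0 := by
  have d : ∀ {i j : ℕ}, i + j ≤ 4 → HasWeakDeriv B i j f (weakD B i j f) := hf.hasWeakDeriv
  have d10 := d (i := 1) (j := 0) (by norm_num)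
  have d20 := d (i := 2) (j := 0) (by norm_num)
  have d30 := d (i := 3) (j := 0) (by norm_num)
  have d40 := d (i := 4) (j := 0) (by norm_num)
  have d50 := hasWeakDeriv_weakD hf5
  have e1 := (d40.succ_x d50).inner_eq_neg_inner_x hb.zero (leftSide_subset B)
  have e2 := (d30.succ_x d40).inner_eq_neg_inner_x hb.dx subset_rfl
  rw [(d10.succ_x d20).weakD_eq] at e2
  have e3 := (d20.succ_x d30).inner_nonpos
  linarith

theorem MemH.mono {m n : ℕ} (hf : MemH B m f) (hn : n ≤ m) : MemH B n f :=
  fun i j hij => hf i j (hij.trans hn)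

/-- `γ ‖∇f‖² + (a²/4) ‖f‖² ≤ ‖Δf‖²`. -/
theorem gradient_le_laplacian (hB : 0 < B) {γ a : ℝ} (hγ : γ ≤ 1 / 8)
    (ha : a ^ 2 = Real.pi ^ 2 / B ^ 2) (ha1 : 1 < a ^ 2) (hf : MemH B 2 f)
    (hb : BoundaryConditions B f) :
    γ * (‖weakD B 1 0 f‖ ^ 2 + ‖weakD B 0 1 f‖ ^ 2) + a ^ 2 / 4 * ‖f‖ ^ 2
      ≤ ‖laplacian B f‖ ^ 2 := by
  have h1 := hb.zero.norm_sq_le hB (horizontalSides_subset B)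
  rw [div_pow, ← ha] at h1
  have h2 := abs_real_inner_le_norm (laplacian B f) f
  rw [inner_laplacian_self hf hb, abs_neg] at h2
  set P := ‖weakD B 1 0 f‖ ^ 2 + ‖weakD B 0 1 f‖ ^ 2 with hP
  have hP0 : 0 ≤ P := by positivity
  rw [abs_of_nonneg hP0] at h2
  have h3 : a ^ 2 * ‖f‖ ^ 2 ≤ P := h1.trans (by rw [hP]; linarith [sq_nonneg ‖weakD B 1 0 f‖])
  set X := ‖laplacian B f‖
  set Y := ‖f‖
  have hX : 0 ≤ X := norm_nonneg _
  have hY : 0 ≤ Y := norm_nonneg _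
  -- Divide `a² Y² ≤ P ≤ X Y` by `Y`; the case `Y = 0` is separate.
  have h4 : a ^ 2 * Y ≤ X := by
    rcases hY.eq_or_lt with h | h
    · rw [← h, mul_zero]
      exact hX
    · refine le_of_mul_le_mul_right ?_ h
      nlinarith
  have h5 : Y ≤ X := by nlinarith
  have h6 : γ * P ≤ 1 / 8 * X ^ 2 := by
    have : P ≤ X ^ 2 := by nlinarith
    nlinarith
  -- The product of `h4` and `h5` is `a² Y² ≤ X²`, so the left side is at most `(1/8 + 1/4) X²`.
  nlinarith [mul_le_mul h4 h5 hY hX]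

theorem inner_timeDeriv_le (hB : 0 < B) {γ a : ℝ} (hγ : γ ≤ 1 / 8)
    (ha : a ^ 2 = Real.pi ^ 2 / B ^ 2) (ha1 : 1 < a ^ 2) (hf : MemH B 4 f)
    (hf5 : ∃ g : L2 B, HasWeakDeriv B 5 0 f g) (hb : BoundaryConditions B f) {v : L2 B}
    (heq : ∀ᵐ p ∂volume.restrict (halfStrip B),
      v p + bilaplacian B f p + γ * laplacian B f p + laplacianDx B f p
        + f p * weakD B 1 0 f p - weakD B 5 0 f p = 0) :
    inner ℝ v f ≤ -(a ^ 2 / 4) * ‖f‖ ^ 2 := by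
  -- The equation itself expresses `f f_x` through elements of `L²(D)`, so its square integrability
  -- needs no Sobolev embedding.
  set N : L2 B := weakD B 5 0 f - v - bilaplacian B f - γ • laplacian B f - laplacianDx B f
    with hN
  have hNeq : ∀ᵐ p ∂volume.restrict (halfStrip B), N p = f p * weakD B 1 0 f p := by
    filter_upwards [heq,
      Lp.coeFn_sub (weakD B 5 0 f - v - bilaplacian B f - γ • laplacian B f) (laplacianDx B f),
      Lp.coeFn_sub (weakD B 5 0 f - v - bilaplacian B f) (γ • laplacian B f),
      Lp.coeFn_sub (weakD B 5 0 f - v) (bilaplacian B f), Lp.coeFn_sub (weakD B 5 0 f) v,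
      Lp.coeFn_smul γ (laplacian B f)] with p h0 h1 h2 h3 h4 h5
    simp only [Pi.sub_apply, Pi.smul_apply, smul_eq_mul] at h1 h2 h3 h4 h5
    rw [h1, h2, h3, h4, h5]
    linarith
  have h0 := hb.zero.inner_eq_zero_of_eq_mul (leftSide_subset B) hNeq
  rw [hN] at h0
  simp only [inner_sub_left, real_inner_smul_left] at h0
  rw [inner_bilaplacian_self hf hb, inner_laplacian_self (hf.mono (by norm_num)) hb] at h0
  have h1 := inner_laplacianDx_self_nonneg (hf.mono (by norm_num)) hb
  have h2 := inner_weakD_five_self_nonpos hf hf5 hb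
  have h3 := gradient_le_laplacian hB hγ ha ha1 (hf.mono (by norm_num)) hb
  linarith

end Energy

/-! ### Decay in time -/

/-- Exponential decay of the squared norm of a Lipschitz primitive `u` of `v` with
`(v, u) ≤ -c ‖u‖²` almost everywhere. -/
theorem norm_sq_le_of_inner_le {H : Type*} [NormedAddCommGroup H] [InnerProductSpace ℝ H]
    [CompleteSpace H] {T c M : ℝ} (hc : 0 ≤ c) {u v : ℝ → H}
    (hv : IntegrableOn v (Ioo 0 T) volume)
    (hu : ∀ t ∈ Icc (0 : ℝ) T, u t = u 0 + ∫ s in Ioo 0 t, v s)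
    (hM : ∀ᵐ t ∂volume.restrict (Ioo 0 T), ‖v t‖ ≤ M)
    (hle : ∀ᵐ t ∂volume.restrict (Ioo 0 T), inner ℝ (v t) (u t) ≤ -c * ‖u t‖ ^ 2) :
    ∀ t ∈ Icc (0 : ℝ) T, ‖u t‖ ^ 2 ≤ ‖u 0‖ ^ 2 * Real.exp (-(2 * c) * t) := by
  have hsub : ∀ {x z : ℝ}, 0 ≤ x → z ≤ T → Ioo x z ⊆ Ioo 0 T := fun hx hz => Ioo_subset_Ioo hx hz
  have hvI : ∀ {x z : ℝ}, 0 ≤ x → x ≤ z → z ≤ T → IntervalIntegrable v volume x z := by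
    intro x z hx hxz hz
    rw [intervalIntegrable_iff_integrableOn_Ioo_of_le hxz]
    exact hv.mono_set (hsub hx hz)
  have hincr : ∀ {x z : ℝ}, 0 ≤ x → x ≤ z → z ≤ T → u z - u x = ∫ s in Ioo x z, v s := by
    intro x z hx hxz hz
    have h1 := intervalIntegral.integral_add_adjacent_intervals
      (hvI le_rfl hx (hxz.trans hz)) (hvI hx hxz hz)
    rw [intervalIntegral.integral_of_le hx, intervalIntegral.integral_of_le hxz,
      intervalIntegral.integral_of_le (hx.trans hxz), integral_Ioc_eq_integral_Ioo,
      integral_Ioc_eq_integral_Ioo, integral_Ioc_eq_integral_Ioo] at h1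
    rw [hu z ⟨hx.trans hxz, hz⟩, hu x ⟨hx, hxz.trans hz⟩, ← h1]
    abel
  have hlip : ∀ {x z : ℝ}, 0 ≤ x → x ≤ z → z ≤ T → ‖u z - u x‖ ≤ M * (z - x) := by
    intro x z hx hxz hz
    rw [hincr hx hxz hz]
    have h1 := norm_setIntegral_le_of_norm_le_const_ae' (μ := volume) (s := Ioo x z) (f := v)
      (C := M) (by simp)
      ((ae_restrict_iff' measurableSet_Ioo).1 (ae_restrict_of_ae_restrict_of_subset (hsub hx hz) hM))
    rwa [Real.volume_real_Ioo_of_le hxz] at h1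
  have hcont : ContinuousOn u (Icc 0 T) := by
    have hdist : LipschitzOnWith (Real.toNNReal M) u (Icc 0 T) := by
      refine LipschitzOnWith.of_dist_le_mul fun z hz x hx => ?_
      rw [Real.dist_eq, dist_eq_norm]
      have hM' : M ≤ Real.toNNReal M := Real.le_coe_toNNReal M
      rcases le_total x z with h | h
      · refine (hlip hx.1 h hz.2).trans ?_
        rw [abs_of_nonneg (sub_nonneg.2 h)]
        exact mul_le_mul_of_nonneg_right hM' (sub_nonneg.2 h)
      · rw [norm_sub_rev, abs_sub_comm]
        refine (hlip hz.1 h hx.2).trans ?_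
        rw [abs_of_nonneg (sub_nonneg.2 h)]
        exact mul_le_mul_of_nonneg_right hM' (sub_nonneg.2 h)
    exact hdist.continuousOn
  -- The hypothesis `hle` holds only almost everywhere, while Gronwall's lemma needs a bound on
  -- right difference quotients at every point. Integrating over `(x, z)` bridges the gap: replacing
  -- `u z` and `u x` by `u r` in the inner product costs `M² (z - x)` each, and replacing `‖u r‖²`
  -- by `‖u x‖²` costs the term with `4 c ‖u x‖ M`.
  have hslope : ∀ {x z : ℝ}, 0 ≤ x → x < z → z ≤ T → ‖u z‖ ^ 2 - ‖u x‖ ^ 2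
      ≤ (z - x) * (-(2 * c) * ‖u x‖ ^ 2 + (4 * c * ‖u x‖ * M + 2 * M ^ 2) * (z - x)) := by
    intro x z hx hxz hz
    have hvz : IntegrableOn v (Ioo x z) volume := hv.mono_set (hsub hx hz)
    have h1 : ‖u z‖ ^ 2 - ‖u x‖ ^ 2 = ∫ r in Ioo x z, inner ℝ (u z + u x) (v r) := by
      rw [integral_inner hvz, ← hincr hx hxz.le hz, inner_sub_right, inner_add_left,
        inner_add_left, real_inner_self_eq_norm_sq, real_inner_self_eq_norm_sq,
        real_inner_comm (u z) (u x)]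
      ring
    have h2 : ∀ᵐ r ∂volume.restrict (Ioo x z), inner ℝ (u z + u x) (v r)
        ≤ -(2 * c) * ‖u x‖ ^ 2 + (4 * c * ‖u x‖ * M + 2 * M ^ 2) * (z - x) := by
      filter_upwards [ae_restrict_of_ae_restrict_of_subset (hsub hx hz) hM,
        ae_restrict_of_ae_restrict_of_subset (hsub hx hz) hle,
        ae_restrict_mem measurableSet_Ioo] with r hMr hler hr
      have hM0 : 0 ≤ M := (norm_nonneg _).trans hMr
      have h3 : ‖u z - u r‖ ≤ M * (z - x) :=
        (hlip (hx.trans hr.1.le) hr.2.le hz).trans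
          (mul_le_mul_of_nonneg_left (by linarith [hr.1]) hM0)
      have h4 : ‖u r - u x‖ ≤ M * (z - x) :=
        (hlip hx hr.1.le (hr.2.le.trans hz)).trans
          (mul_le_mul_of_nonneg_left (by linarith [hr.2]) hM0)
      have h5 : inner ℝ (u z + u x) (v r)
          = 2 * inner ℝ (v r) (u r) + inner ℝ (u z - u r) (v r) - inner ℝ (u r - u x) (v r) := by
        rw [real_inner_comm (u r) (v r)]
        simp only [inner_add_left, inner_sub_left]
        ring
      have hb : ∀ d : H, ‖d‖ ≤ M * (z - x) → |inner ℝ d (v r)| ≤ M ^ 2 * (z - x) := by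
        intro d hd
        calc |inner ℝ d (v r)| ≤ ‖d‖ * ‖v r‖ := abs_real_inner_le_norm _ _
          _ ≤ M * (z - x) * M := mul_le_mul hd hMr (norm_nonneg _) ((norm_nonneg _).trans hd)
          _ = M ^ 2 * (z - x) := by ring
      have h6 := (abs_le.1 (hb _ h3)).2
      have h7 := (abs_le.1 (hb _ h4)).1
      have h8 : ‖u x‖ ^ 2 - 2 * ‖u x‖ * (M * (z - x)) ≤ ‖u r‖ ^ 2 := by
        have h9 : ‖u r‖ ^ 2 = ‖u x‖ ^ 2 + 2 * inner ℝ (u x) (u r - u x) + ‖u r - u x‖ ^ 2 := by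
          rw [← norm_add_sq_real, add_sub_cancel]
        have h10 := (abs_le.1 (abs_real_inner_le_norm (u x) (u r - u x))).1
        have h11 := mul_le_mul_of_nonneg_left h4 (norm_nonneg (u x))
        linarith [sq_nonneg ‖u r - u x‖]
      have h12 := mul_le_mul_of_nonneg_left h8 hc
      rw [h5]
      linarith
    rw [h1]
    have h3 := integral_mono_ae (hvz.const_inner (u z + u x))
      (integrable_const (μ := volume.restrict (Ioo x z)) _) h2
    simpa [hxz.le] using h3
  intro t ht
  have key := le_gronwallBound_of_liminf_deriv_right_le (f := fun t => ‖u t‖ ^ 2)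
    (f' := fun t => -(2 * c) * ‖u t‖ ^ 2) (δ := ‖u 0‖ ^ 2) (K := -(2 * c)) (ε := 0) (a := 0)
    (b := T) (hcont.norm.pow 2) (fun x hx ρ hρ => ?_) le_rfl (fun x _ => by simp) t ht
  · rwa [gronwallBound_ε0, sub_zero] at key
  · refine Eventually.frequently ?_
    have hlim : Tendsto (fun z => -(2 * c) * ‖u x‖ ^ 2
        + (4 * c * ‖u x‖ * M + 2 * M ^ 2) * (z - x)) (𝓝[>] x) (𝓝 (-(2 * c) * ‖u x‖ ^ 2)) := by
      refine tendsto_nhdsWithin_of_tendsto_nhds ?_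
      have : Continuous fun z => -(2 * c) * ‖u x‖ ^ 2
        + (4 * c * ‖u x‖ * M + 2 * M ^ 2) * (z - x) := by fun_prop
      simpa using this.tendsto x
    filter_upwards [hlim.eventually (gt_mem_nhds hρ), Ioo_mem_nhdsGT hx.2] with z hz hzx
    refine lt_of_le_of_lt ?_ hz
    rw [inv_mul_le_iff₀ (sub_pos.2 hzx.1)]
    exact hslope hx.1 hzx.1 hzx.2.le

/-- Order zero suffices because `weakD B 0 0` is the identity. -/
theorem ae_norm_le_of_memBochner_top {B T : ℝ} {v : ℝ → L2 B} (hv : MemBochner B T ⊤ 0 v) :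
    ∃ M : ℝ, ∀ᵐ t ∂volume.restrict (Ioo 0 T), ‖v t‖ ≤ M := by
  have h := (hv 0 0 le_rfl).2
  simp only [(hasWeakDeriv_zero_zero _).weakD_eq] at h
  have hfin := h.2
  rw [eLpNorm_exponent_top] at hfin
  refine ⟨(eLpNormEssSup v (volume.restrict (Ioo 0 T))).toReal, ?_⟩
  filter_upwards [ae_le_eLpNormEssSup (f := v) (μ := volume.restrict (Ioo 0 T))] with t ht
  simpa using ENNReal.toReal_mono hfin.ne ht

theorem theorem6p3 (B γ k a : ℝ) (hB : 0 < B)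
    (hγ : γ ∈ Set.Ioo (0 : ℝ) (1 / 8)) (hk : k ∈ Set.Ioo (0 : ℝ) (1 / 4))
    (ha : a ^ 2 = Real.pi ^ 2 / B ^ 2) (ha1 : 1 < a ^ 2)
    (u₀ : L2 B) (hu₀ : AdmissibleDatum B k u₀)
    (hsmall : weightedSq B k u₀ < ENNReal.ofReal (9 / (8 * k) * a ^ 2))
    (T : ℝ) (hT : 0 < T) (u : ℝ → L2 B) (hu : IsRegularSolution B γ T u₀ u) :
    ∀ t ∈ Set.Icc (0 : ℝ) T,
      ‖u t‖ ^ 2 ≤ ‖u₀‖ ^ 2 * Real.exp (-(1 / 2 * a ^ 2) * t) := by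
  obtain ⟨v, hv⟩ := hu
  obtain ⟨M, hM⟩ := ae_norm_le_of_memBochner_top hv.timeDeriv_memLinfL2
  have hH4 : ∀ᵐ t ∂volume.restrict (Ioo 0 T), MemH B 4 (u t) := by
    simp only [MemH, ae_all_iff]
    exact fun i j hij => (hv.memL2H4 i j hij).1
  have hle : ∀ᵐ t ∂volume.restrict (Ioo 0 T),
      inner ℝ (v t) (u t) ≤ -(a ^ 2 / 4) * ‖u t‖ ^ 2 := by
    filter_upwards [hH4, hv.memL2Dx5.1, hv.boundary, hv.equation] with t h4 h5 hb heq
    exact inner_timeDeriv_le hB hγ.2.le ha ha1 h4 h5 hb heq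
  have key := norm_sq_le_of_inner_le (by positivity : 0 ≤ a ^ 2 / 4) hv.timeDeriv.1
    hv.timeDeriv.2 hM hle
  intro t ht
  have h := key t ht
  rwa [hv.initial, show 2 * (a ^ 2 / 4) = 1 / 2 * a ^ 2 by ring] at h
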